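/- Let $\Omega$ be a non-empty set and let $\ge_*$ be a reflexive and transitive relation on the set of real functions on $\Omega$, with asymmetric part $>_*$, such that: $1>_*0$; $f\ge g$ pointwise implies $f\ge_*g$; $f\ge_*g$ implies $bf+h\ge_*bg+h$ for every bounded $b\ge0$ and every $h:\Omega\to\mathbb R$; and $f>_*0$ implies $f\wedge1>_*0$. Let $\mathcal X$ be a convex set of real functions on $\Omega$ containing $0$ and $1$, such that every $X\in\mathcal X$ satisfies $X\ge_*a$ for some $a\in\mathbb R$, and such that $X+\lambda\in\mathcal X$ for all $X\in\mathcal X$, $\lambda\ge0$. A price function on a set $S$ of real functions on $\Omega$ is a map $\rho:S\to\mathbb R$ that is positively homogeneous and subadditive (whenever the functions involved belong to $S$), with $\rho(1)=1$, such that $X\ge_*Y$ implies $\rho(X)\ge\rho(Y)$ and $X>_*0$ implies $\rho(X)>0$, for $X,Y\in S$. It is cash additive if $\rho(X+a)=\rho(X)+a$ whenever $a\in\mathbb R$ and $X,X+a\in S$. Let $\pi$ be a price function on $\mathcal X$ and put $$\mathcal X_1=\{X\wedge k: X\in\mathcal X,\ k\in\mathbb R_+\cup\{+\infty\}\},\qquad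 L(\mathcal X)=\{g:\Omega\to\mathbb R:\ \lambda X\ge_*|g|\text{ for some }\lambda>0,\ X\in\mathcal X\},$$ $$\mathscr C(\pi)=\{g:\Omega\to\mathbb R:\ \lambda[X-\pi(X)]\ge_*g\text{ for some }\lambda>0,\ X\in\mathcal X\}.$$ Let $\mathscr M_0(\pi)$ be the set of finitely additive probabilities $m$ on the power set of $\Omega$ that vanish on every negligible set (every $A\subset\Omega$ with $0\ge_*1_A$) and are such that $L(\mathcal X)\subset L^1(m)$ and $\int X\,dm\le\pi(X)$ for all $X\in\mathcal X$ (integrals in the sense of Dunford and Schwartz). Then the following three conditions are equivalent: (i) the market $(\mathcal X,\ge_*,\pi)$ admits a cash-additive extension $(\mathcal X_1,\ge_*,\pi_1)$, that is, there is a cash-additive price function $\pi_1$ on $\mathcal X_1$ with $\pi_1(X)\le\pi(X)$ for all $X\in\mathcal X$; (ii) the closure of $\mathscr C(\pi)$ in the topology of uniform distance contains no $f\in\mathcal X_1$ with $f>_*0$; (iii) $\displaystyle\sup_{m\in\mathscr M_0(\pi)}\int(f\wedge1)\,dm>0$ for every $f\in\mathcal X_1$ with $f>_*0$. -/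

import Mathlib

open Set Filter Topology

/-- A criterion of collective rationality `≥_*` on the real functions on `Ω`: a reflexive and
transitive relation with `1 >_* 0`, extending the pointwise order, stable under multiplication by
bounded nonnegative functions and under translations, and whose strict part survives truncation
at `1`.  `ge f g` reads `f ≥_* g`. -/
structure IsCommonOrder {Ω : Type*} (ge : (Ω → ℝ) → (Ω → ℝ) → Prop) : Prop where
  refl : ∀ f, ge f f
  trans : ∀ f g h, ge f g → ge g h → ge f h
  one_gt_zero : ge 1 0 ∧ ¬ ge 0 1
  of_le : ∀ f g : Ω → ℝ, (∀ ω, g ω ≤ f ω) → ge f g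
  affine : ∀ f g b h : Ω → ℝ, ge f g → (∀ ω, 0 ≤ b ω) → (∃ C : ℝ, ∀ ω, b ω ≤ C) →
    ge (b * f + h) (b * g + h)
  trunc : ∀ f : Ω → ℝ, (ge f 0 ∧ ¬ ge 0 f) → (ge (f ⊓ 1) 0 ∧ ¬ ge 0 (f ⊓ 1))

/-- The asymmetric part: `StrictOf ge f g` reads `f >_* g`. -/
def StrictOf {Ω : Type*} (ge : (Ω → ℝ) → (Ω → ℝ) → Prop) (f g : Ω → ℝ) : Prop :=
  ge f g ∧ ¬ ge g f

/-- The constant function with value `a`. -/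
def constFun (Ω : Type*) (a : ℝ) : Ω → ℝ := fun _ => a

/-- The set of traded payoffs: convex, containing `0` and `1`, each payoff `≥_*`-bounded below by
a constant, and stable under the addition of nonnegative constants. -/
structure IsAssetSet {Ω : Type*} (ge : (Ω → ℝ) → (Ω → ℝ) → Prop) (𝒳 : Set (Ω → ℝ)) : Prop where
  convex : Convex ℝ 𝒳
  zero_mem : (0 : Ω → ℝ) ∈ 𝒳
  one_mem : (1 : Ω → ℝ) ∈ 𝒳
  bounded_below : ∀ f ∈ 𝒳, ∃ a : ℝ, ge f (constFun Ω a)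
  add_const_mem : ∀ f ∈ 𝒳, ∀ a : ℝ, 0 ≤ a → f + constFun Ω a ∈ 𝒳

/-- `π` is a price function on the set `S` of payoffs (only the values of `π` on `S` matter):
positively homogeneous and subadditive (whenever the payoffs involved belong to `S`), normalised,
`≥_*`-monotone and free of arbitrage. -/
structure IsPriceFunction {Ω : Type*} (ge : (Ω → ℝ) → (Ω → ℝ) → Prop) (S : Set (Ω → ℝ))
    (π : (Ω → ℝ) → ℝ) : Prop where
  pos_homogeneous : ∀ f ∈ S, ∀ c : ℝ, 0 ≤ c → c • f ∈ S → π (c • f) = c * π f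
  subadditive : ∀ f ∈ S, ∀ g ∈ S, f + g ∈ S → π (f + g) ≤ π f + π g
  map_one : π 1 = 1
  monotone : ∀ f ∈ S, ∀ g ∈ S, ge f g → π g ≤ π f
  no_arbitrage : ∀ f ∈ S, StrictOf ge f 0 → 0 < π f

/-- Cash additivity of `π` on `S`. -/
def IsCashAdditive {Ω : Type*} (S : Set (Ω → ℝ)) (π : (Ω → ℝ) → ℝ) : Prop :=
  ∀ f ∈ S, ∀ a : ℝ, f + constFun Ω a ∈ S → π (f + constFun Ω a) = π f + a

/-- `𝒳₁ = {X ∧ k : X ∈ 𝒳, k ∈ ℝ₊ ∪ {+∞}}`. -/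
def truncatedAssets {Ω : Type*} (𝒳 : Set (Ω → ℝ)) : Set (Ω → ℝ) :=
  {f | f ∈ 𝒳 ∨ ∃ X ∈ 𝒳, ∃ k : ℝ, 0 ≤ k ∧ f = X ⊓ constFun Ω k}

/-- `L(𝒳)`: the functions `g` with `λ X ≥_* |g|` for some `λ > 0`, `X ∈ 𝒳`. -/
def completeAssets {Ω : Type*} (ge : (Ω → ℝ) → (Ω → ℝ) → Prop) (𝒳 : Set (Ω → ℝ)) :
    Set (Ω → ℝ) :=
  {g | ∃ c : ℝ, 0 < c ∧ ∃ X ∈ 𝒳, ge (c • X) |g|}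

/-- `𝒞(π)`: the functions `g` with `λ [X - π(X)] ≥_* g` for some `λ > 0`, `X ∈ 𝒳`. -/
def priceCone {Ω : Type*} (ge : (Ω → ℝ) → (Ω → ℝ) → Prop) (𝒳 : Set (Ω → ℝ))
    (π : (Ω → ℝ) → ℝ) : Set (Ω → ℝ) :=
  {g | ∃ c : ℝ, 0 < c ∧ ∃ X ∈ 𝒳, ge (c • (X - constFun Ω (π X))) g}

/-- The closure of `A` in the topology of uniform distance. -/
def uniformClosure {Ω : Type*} (A : Set (Ω → ℝ)) : Set (Ω → ℝ) :=
  {f | UniformFun.ofFun f ∈ closure ((fun g : Ω → ℝ => UniformFun.ofFun g) '' A)}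

/-- Finitely additive probabilities on the power set of `Ω`. -/
structure FinAddProb (Ω : Type*) where
  toFun : Set Ω → ℝ
  nonneg' : ∀ A, 0 ≤ toFun A
  univ' : toFun univ = 1
  union' : ∀ A B, Disjoint A B → toFun (A ∪ B) = toFun A + toFun B

namespace FinAddProb

/-- The integral of a simple function (a function with finite range): `∑ y, y * m {s = y}`. -/
noncomputable def simpleIntegral {Ω : Type*} (m : FinAddProb Ω) (s : Ω → ℝ) : ℝ :=
  ∑ᶠ y : ℝ, y * m.toFun (s ⁻¹' {y})

/-- `f` has Dunford-Schwartz integral `I` with respect to `m`: there is a sequence of simple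
functions converging to `f` in `m`-measure, Cauchy in `L¹(m)`, whose integrals converge to `I`. -/
def HasIntegral {Ω : Type*} (m : FinAddProb Ω) (f : Ω → ℝ) (I : ℝ) : Prop :=
  ∃ s : ℕ → Ω → ℝ, (∀ n, (range (s n)).Finite) ∧
    (∀ ε : ℝ, 0 < ε → Tendsto (fun n => m.toFun {ω | ε < |s n ω - f ω|}) atTop (𝓝 0)) ∧
    (∀ ε : ℝ, 0 < ε → ∃ N : ℕ, ∀ n ≥ N, ∀ k ≥ N, m.simpleIntegral |s n - s k| < ε) ∧
    Tendsto (fun n => m.simpleIntegral (s n)) atTop (𝓝 I)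

/-- `f ∈ L¹(m)`. -/
def Integrable {Ω : Type*} (m : FinAddProb Ω) (f : Ω → ℝ) : Prop :=
  ∃ I : ℝ, m.HasIntegral f I

open Classical in
/-- `∫ f dm`, with the value `0` if `f ∉ L¹(m)`. -/
noncomputable def integral {Ω : Type*} (m : FinAddProb Ω) (f : Ω → ℝ) : ℝ :=
  if h : m.Integrable f then Classical.choose h else 0

end FinAddProb

/-- The negligible sets: those `A` with `0 ≥_* 1_A`. -/
def negligibleSets {Ω : Type*} (ge : (Ω → ℝ) → (Ω → ℝ) → Prop) : Set (Set Ω) :=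
  {A | ge 0 (A.indicator 1)}

/-- The pricing measures `ℳ₀(π)`: the finitely additive probabilities `m` vanishing on the
negligible sets, with `L(𝒳) ⊆ L¹(m)` and `∫ X dm ≤ π(X)` for all `X ∈ 𝒳`. -/
def pricingMeasures {Ω : Type*} (ge : (Ω → ℝ) → (Ω → ℝ) → Prop) (𝒳 : Set (Ω → ℝ))
    (π : (Ω → ℝ) → ℝ) : Set (FinAddProb Ω) :=
  {m | (∀ A ∈ negligibleSets ge, m.toFun A = 0) ∧
    (∀ f ∈ completeAssets ge 𝒳, m.Integrable f) ∧ ∀ X ∈ 𝒳, m.integral X ≤ π X}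

/-- `π₁` is the price function of a cash-additive extension `(S, ≥_*, π₁)` of the market
`(𝒳, ≥_*, π)`: a cash-additive price function on `S` whose restriction to `𝒳` is `≤ π`. -/
def IsCashAdditiveExtension {Ω : Type*} (ge : (Ω → ℝ) → (Ω → ℝ) → Prop) (𝒳 : Set (Ω → ℝ))
    (π : (Ω → ℝ) → ℝ) (S : Set (Ω → ℝ)) (π₁ : (Ω → ℝ) → ℝ) : Prop :=
  IsPriceFunction ge S π₁ ∧ IsCashAdditive S π₁ ∧ ∀ X ∈ 𝒳, π₁ X ≤ π X

/-! The three conditions are linked in a cycle. From (i) to (ii): if `f` is a uniform limit of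
`𝒞(π)`, then for every `ε > 0` some `λ[X - π(X)]` dominates `f - ε`. After scaling, and moving
constants so that both sides lie in `𝒳₁`, monotonicity, cash additivity and `π₁ ≤ π` give `π₁(f) ≤
ε`. Hence `π₁(f) ≤ 0`, which excludes `f >_* 0`. From (ii) to (iii): `v = f ∧ 1` is again a strictly
positive element of `𝒳₁`, so `v - ε ∉ 𝒞(π)` for some `ε > 0`. The constant `1` is an order unit of
`L(𝒳)` modulo the cone `𝒞(π)`, and M. Riesz extension (`exists_linear_nonpos_on_cone`) yields a
linear `φ` with `φ(1) = 1`, `φ ≤ 0` on `𝒞(π) ∩ L(𝒳)` and `φ(v) ≥ ε`. Put `m(A) = φ(1_A)`. The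
functional may exceed the integral by a part that vanishes on bounded functions, so only one-sided
comparisons hold (`exists_hasIntegral_ofLinear`): `∫ g dm ≤ φ(g)` for `g` bounded below and `φ(g) ≤
∫ g dm` for `g` bounded above. These suffice: `∫ X dm ≤ φ(X) ≤ π(X)` and `∫ v dm ≥ φ(v) > 0`. From
(iii) to (i): `π₁(f) = sup ∫ f dm` over the pricing measures is cash additive, since all of them
have mass one, and monotone, since they ignore negligible sets. -/

/-! ### Arithmetic of the order. -/

namespace IsCommonOrder

variable {Ω : Type*} {ge : (Ω → ℝ) → (Ω → ℝ) → Prop}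

theorem mono (hge : IsCommonOrder ge) {f g f' g' : Ω → ℝ} (h : ge f g)
    (hf : ∀ ω, f ω ≤ f' ω) (hg : ∀ ω, g' ω ≤ g ω) : ge f' g' :=
  hge.trans _ _ _ (hge.of_le _ _ hf) (hge.trans _ _ _ h (hge.of_le _ _ hg))

theorem add_right (hge : IsCommonOrder ge) {f g : Ω → ℝ} (h : ge f g) (k : Ω → ℝ) :
    ge (f + k) (g + k) := by
  simpa using hge.affine f g 1 k h (fun _ => zero_le_one) ⟨1, fun _ => le_rfl⟩

theorem mul_left (hge : IsCommonOrder ge) {f g : Ω → ℝ} (h : ge f g) {b : Ω → ℝ}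
    (hb : ∀ ω, 0 ≤ b ω) {C : ℝ} (hC : ∀ ω, b ω ≤ C) : ge (b * f) (b * g) := by
  simpa using hge.affine f g b 0 h hb ⟨C, hC⟩

theorem smul (hge : IsCommonOrder ge) {f g : Ω → ℝ} (h : ge f g) {c : ℝ} (hc : 0 ≤ c) :
    ge (c • f) (c • g) :=
  hge.mul_left (b := fun _ => c) h (fun _ => hc) (fun _ => le_rfl)

theorem add (hge : IsCommonOrder ge) {f g f' g' : Ω → ℝ} (h : ge f g) (h' : ge f' g') :
    ge (f + f') (g + g') := by
  have := hge.add_right h' g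
  exact hge.trans _ _ _ (hge.add_right h f') (by simpa [add_comm] using this)

theorem sub_nonneg (hge : IsCommonOrder ge) {f g : Ω → ℝ} (h : ge f g) : ge (f - g) 0 := by
  simpa [sub_eq_add_neg] using hge.add_right h (-g)

/-- If `f ≥_* g`, then `f` falls short of `g` by more than `ε` only on a negligible set. -/
theorem negligible_of_ge (hge : IsCommonOrder ge) {f g : Ω → ℝ} (h : ge f g) {ε : ℝ}
    (hε : 0 < ε) : {ω | f ω + ε < g ω} ∈ negligibleSets ge := by
  set A : Set Ω := {ω | f ω + ε < g ω} with hA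
  -- On `A` the function `(f - g)/ε` is below `-1`, so `1_A (f - g)/ε + 1_A ≤ 0` pointwise, while
  -- this sum is `≥_* 1_A`.
  have h1 := hge.smul (hge.mul_left (hge.sub_nonneg h) (b := A.indicator 1) (C := 1)
    (fun ω => indicator_nonneg (fun _ _ => zero_le_one) ω)
    (fun ω => indicator_le_self' (fun _ _ => zero_le_one) ω)) (inv_nonneg.2 hε.le)
  have h2 := hge.add_right h1 (A.indicator 1)
  refine hge.mono h2 (fun ω => ?_) (fun ω => by simp)
  by_cases hω : ω ∈ A
  · have : f ω + ε < g ω := hω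
    have h3 : ε⁻¹ * (f ω - g ω) ≤ ε⁻¹ * (-ε) :=
      mul_le_mul_of_nonneg_left (by linarith) (inv_nonneg.2 hε.le)
    have h4 : ε⁻¹ * (-ε) = -1 := by field_simp
    simp only [Pi.add_apply, Pi.smul_apply, Pi.mul_apply, Pi.sub_apply, smul_eq_mul,
      indicator_of_mem hω, Pi.one_apply, one_mul, Pi.zero_apply]
    linarith
  · simp [indicator_of_notMem hω]

end IsCommonOrder

/-! ### Functions with finite range. -/

section FiniteRange

variable {Ω : Type*}

theorem Set.Finite.range_map₂ {s t : Ω → ℝ} (hs : (range s).Finite) (ht : (range t).Finite)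
    (u : ℝ → ℝ → ℝ) : (range fun ω => u (s ω) (t ω)).Finite :=
  (hs.image2 u ht).subset (range_subset_iff.2 fun ω => ⟨s ω, ⟨ω, rfl⟩, t ω, ⟨ω, rfl⟩, rfl⟩)

theorem Set.Finite.range_map {s : Ω → ℝ} (hs : (range s).Finite) (u : ℝ → ℝ) :
    (range fun ω => u (s ω)).Finite :=
  hs.range_map₂ hs fun x _ => u x

theorem Set.Finite.exists_abs_le {s : Ω → ℝ} (hs : (range s).Finite) :
    ∃ M : ℝ, 0 ≤ M ∧ ∀ ω, |s ω| ≤ M := by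
  obtain ⟨M, hM⟩ := (hs.range_map fun x => |x|).bddAbove
  exact ⟨max M 0, le_max_right _ _, fun ω => (hM ⟨ω, rfl⟩).trans (le_max_left _ _)⟩

end FiniteRange

/-! ### The integral of simple functions. -/

namespace FinAddProb

variable {Ω : Type*} (m : FinAddProb Ω)

theorem empty : m.toFun ∅ = 0 := by
  have := m.union' ∅ ∅ (disjoint_empty _)
  simp only [union_self] at this
  linarith

theorem mono {A B : Set Ω} (h : A ⊆ B) : m.toFun A ≤ m.toFun B := by
  have := m.union' A (B \ A) disjoint_sdiff_right
  rw [union_sdiff_cancel h] at this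
  linarith [m.nonneg' (B \ A)]

theorem union_le (A B : Set Ω) : m.toFun (A ∪ B) ≤ m.toFun A + m.toFun B := by
  have := m.union' A (B \ A) disjoint_sdiff_right
  rw [union_sdiff_self] at this
  linarith [m.mono (sdiff_subset : B \ A ⊆ B)]

theorem preimage_finset {β : Type*} (g : Ω → β) (G : Finset β) :
    m.toFun (g ⁻¹' (G : Set β)) = ∑ z ∈ G, m.toFun (g ⁻¹' {z}) := by
  classical
  induction G using Finset.induction_on with
  | empty => simp [m.empty]
  | insert a G ha ih =>
    rw [Finset.sum_insert ha, ← ih, ← m.union', Finset.coe_insert, insert_eq, preimage_union]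
    exact Disjoint.preimage _ (disjoint_singleton_left.2 (by simpa using ha))

/-- The partition by `g` may be finer than the level sets of the integrand. With `g = (s, t)` two
simple functions share a partition, and linearity and monotonicity become termwise. -/
theorem simpleIntegral_comp {β : Type*} (g : Ω → β) (F : Finset β) (hF : ∀ ω, g ω ∈ F)
    (u : β → ℝ) :
    m.simpleIntegral (fun ω => u (g ω)) = ∑ z ∈ F, u z * m.toFun (g ⁻¹' {z}) := by
  classical
  rw [simpleIntegral, finsum_eq_sum_of_support_subset (s := F.image u)]
  · rw [← Finset.sum_fiberwise_of_maps_to (t := F.image u) (g := u)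
      (fun z hz => Finset.mem_image_of_mem u hz)]
    refine Finset.sum_congr rfl fun y _ => ?_
    have : (fun ω => u (g ω)) ⁻¹' {y} = g ⁻¹' ((F.filter fun z => u z = y : Finset β) : Set β) := by
      ext ω
      simp [hF ω]
    rw [this, m.preimage_finset, Finset.mul_sum]
    refine Finset.sum_congr rfl fun z hz => ?_
    rw [(Finset.mem_filter.1 hz).2]
  · intro y hy
    by_contra hy'
    apply hy
    have : (fun ω => u (g ω)) ⁻¹' {y} = ∅ := by
      ext ω
      simp only [mem_preimage, mem_singleton_iff, mem_empty_iff_false, iff_false]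
      rintro rfl
      exact hy' (by simpa using ⟨g ω, hF ω, rfl⟩)
    simp [this, m.empty]

theorem simpleIntegral_map₂ {s t : Ω → ℝ} (hs : (range s).Finite) (ht : (range t).Finite)
    (u : ℝ → ℝ → ℝ) :
    m.simpleIntegral (fun ω => u (s ω) (t ω)) =
      ∑ z ∈ hs.toFinset ×ˢ ht.toFinset,
        u z.1 z.2 * m.toFun ((fun ω => (s ω, t ω)) ⁻¹' {z}) :=
  m.simpleIntegral_comp (fun ω => (s ω, t ω)) _ (fun ω => by simp) fun z => u z.1 z.2

variable {m}

theorem simpleIntegral_add {s t : Ω → ℝ} (hs : (range s).Finite) (ht : (range t).Finite) :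
    m.simpleIntegral (s + t) = m.simpleIntegral s + m.simpleIntegral t := by
  have h1 := m.simpleIntegral_map₂ hs ht (fun x y => x + y)
  have h2 := m.simpleIntegral_map₂ hs ht (fun x _ => x)
  have h3 := m.simpleIntegral_map₂ hs ht (fun _ y => y)
  refine h1.trans ((?_ : _ = _).trans (congrArg₂ (· + ·) h2 h3).symm)
  simp only [add_mul, Finset.sum_add_distrib]

theorem simpleIntegral_smul {s : Ω → ℝ} (hs : (range s).Finite) (c : ℝ) :
    m.simpleIntegral (c • s) = c * m.simpleIntegral s := by
  have h1 := m.simpleIntegral_map₂ hs hs (fun x _ => c * x)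
  have h2 := m.simpleIntegral_map₂ hs hs (fun x _ => x)
  refine h1.trans ((?_ : _ = _).trans (congrArg (c * ·) h2).symm)
  simp only [Finset.mul_sum, mul_assoc]

theorem simpleIntegral_mono {s t : Ω → ℝ} (hs : (range s).Finite) (ht : (range t).Finite)
    (h : ∀ ω, s ω ≤ t ω) : m.simpleIntegral s ≤ m.simpleIntegral t := by
  have h2 := m.simpleIntegral_map₂ hs ht (fun x _ => x)
  have h3 := m.simpleIntegral_map₂ hs ht (fun _ y => y)
  refine h2.trans_le (le_of_le_of_eq (Finset.sum_le_sum fun z _ => ?_) h3.symm)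
  by_cases hz : ∃ ω, (s ω, t ω) = z
  · obtain ⟨ω, rfl⟩ := hz
    exact mul_le_mul_of_nonneg_right (h ω) (m.nonneg' _)
  · have : (fun ω => (s ω, t ω)) ⁻¹' {z} = ∅ := by
      ext ω
      simpa using fun h' => hz ⟨ω, h'⟩
    simp [this, m.empty]

theorem simpleIntegral_const (c : ℝ) : m.simpleIntegral (fun _ => c) = c := by
  have := m.simpleIntegral_comp (fun _ : Ω => ()) Finset.univ (by simp) (fun _ => c)
  simpa [m.univ'] using this

theorem simpleIntegral_indicator (A : Set Ω) :
    m.simpleIntegral (A.indicator 1) = m.toFun A := by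
  classical
  have := m.simpleIntegral_comp (fun ω : Ω => decide (ω ∈ A)) Finset.univ
    (fun _ => Finset.mem_univ _)
    (fun b => if b then 1 else 0)
  simp only [Fintype.univ_bool, Bool.false_eq_true, Finset.mem_singleton,
    Bool.true_eq_false, not_false_eq_true, Finset.sum_insert, Finset.sum_singleton, if_true,
    if_false, one_mul, zero_mul, add_zero] at this
  convert this using 2
  · ext ω
    by_cases h : ω ∈ A <;> simp [h]
  · ext ω
    simp

theorem finite_range_indicator (A : Set Ω) : (range (A.indicator (1 : Ω → ℝ))).Finite := by
  refine (toFinite ({0, 1} : Set ℝ)).subset (range_subset_iff.2 fun ω => ?_)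
  by_cases h : ω ∈ A <;> simp [h]

/-! ### The Dunford-Schwartz integral. -/

namespace HasIntegral

variable {f g : Ω → ℝ} {I J : ℝ}

/-- The Dunford-Schwartz integral is monotone for the order modulo null functions. -/
theorem le (hf : m.HasIntegral f I) (hg : m.HasIntegral g J)
    (h : ∀ ε : ℝ, 0 < ε → m.toFun {ω | f ω + ε < g ω} = 0) : J ≤ I := by
  obtain ⟨s, hs, hsm, hsc, hsI⟩ := hf
  obtain ⟨t, ht, htm, htc, htJ⟩ := hg
  refine le_of_forall_pos_le_add fun ε hε => ?_
  have hε3 : 0 < ε / 3 := by positivity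
  obtain ⟨N₁, hN₁⟩ := hsc (ε / 3) hε3
  obtain ⟨N₂, hN₂⟩ := htc (ε / 3) hε3
  set N := max N₁ N₂
  -- The differences `t n - s n` have no common bound, so a bound is taken at the fixed index `N`
  -- and the rest is left to the `L¹` Cauchy property.
  obtain ⟨M, hM0, hM⟩ := ((ht N).range_map₂ (hs N) fun x y => x - y).exists_abs_le
  have hδ : 0 < ε / 9 := by positivity
  have hlim : Tendsto (fun n => m.simpleIntegral (s n) + (ε / 3 +
      M * (m.toFun {ω | ε / 9 < |s n ω - f ω|} + m.toFun {ω | ε / 9 < |t n ω - g ω|})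
      + ε / 3 + ε / 3)) atTop (𝓝 (I + (ε / 3 + M * (0 + 0) + ε / 3 + ε / 3))) :=
    hsI.add ((((tendsto_const_nhds.add
      (((hsm _ hδ).add (htm _ hδ)).const_mul M)).add_const _).add_const _))
  have hle := le_of_tendsto_of_tendsto htJ hlim
    ((eventually_ge_atTop N).mono fun n hn => ?_)
  · linarith
  have hsN := hN₁ n ((le_max_left _ _).trans hn) N (le_max_left _ _)
  have htN := hN₂ n ((le_max_right _ _).trans hn) N (le_max_right _ _)
  -- Off `A`, `t n ≤ s n + ε/3`; on `A`, `t n - s n ≤ M + |s n - s N| + |t n - t N|`. Three errors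
  -- of `ε/9` account for the threshold, so `m(A)` tends to `0`.
  set A : Set Ω := {ω | ε / 3 < t n ω - s n ω} with hA
  have hAm : m.toFun A ≤ m.toFun {ω | ε / 9 < |s n ω - f ω|} +
      m.toFun {ω | ε / 9 < |t n ω - g ω|} := by
    have hsub : A ⊆ ({ω | ε / 9 < |s n ω - f ω|} ∪ {ω | ε / 9 < |t n ω - g ω|}) ∪
        {ω | f ω + ε / 9 < g ω} := by
      intro ω hω
      have hω' : ε / 3 < t n ω - s n ω := hω
      by_contra hcon
      simp only [mem_union, mem_ofPred_eq, not_or, not_lt] at hcon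
      obtain ⟨⟨h1, h2⟩, h3⟩ := hcon
      linarith [(abs_le.1 h1).1, (abs_le.1 h2).2]
    have h1 := (m.mono hsub).trans (m.union_le _ _)
    rw [h _ hδ] at h1
    linarith [m.union_le {ω | ε / 9 < |s n ω - f ω|} {ω | ε / 9 < |t n ω - g ω|}]
  have fs : (range |s n - s N|).Finite := (hs n).range_map₂ (hs N) fun x y => |x - y|
  have ft : (range |t n - t N|).Finite := (ht n).range_map₂ (ht N) fun x y => |x - y|
  have fA : (range (M • A.indicator (1 : Ω → ℝ))).Finite :=
    (finite_range_indicator A).range_map fun x => M * x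
  have fc : (range fun _ : Ω => ε / 3).Finite := fs.range_map fun _ => ε / 3
  have f1 : (range ((fun _ : Ω => ε / 3) + M • A.indicator (1 : Ω → ℝ))).Finite :=
    fc.range_map₂ fA fun x y => x + y
  have f2 : (range ((fun _ : Ω => ε / 3) + M • A.indicator (1 : Ω → ℝ) + |s n - s N|)).Finite :=
    f1.range_map₂ fs fun x y => x + y
  have f3 : (range ((fun _ : Ω => ε / 3) + M • A.indicator (1 : Ω → ℝ) + |s n - s N| +
      |t n - t N|)).Finite := f2.range_map₂ ft fun x y => x + y
  have key := simpleIntegral_mono (m := m) (ht n)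
    ((hs n).range_map₂ f3 fun x y => x + y) (fun ω => ?_)
  · have e := simpleIntegral_add (m := m) (hs n) f3
    rw [simpleIntegral_add f2 ft, simpleIntegral_add f1 fs, simpleIntegral_add fc fA,
      simpleIntegral_const, simpleIntegral_smul (finite_range_indicator A),
      simpleIntegral_indicator] at e
    have := key.trans_eq e
    nlinarith [mul_le_mul_of_nonneg_left hAm hM0]
  · have h1 := neg_abs_le (s n ω - s N ω)
    have h2 := le_abs_self (t n ω - t N ω)
    have h1' := abs_nonneg (s n ω - s N ω)
    have h2' := abs_nonneg (t n ω - t N ω)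
    simp only [Pi.add_apply, Pi.smul_apply, smul_eq_mul, Pi.abs_apply, Pi.sub_apply]
    by_cases hω : ω ∈ A
    · have := (le_abs_self _).trans (hM ω)
      simp only [indicator_of_mem hω, Pi.one_apply, mul_one]
      linarith
    · have : t n ω - s n ω ≤ ε / 3 := not_lt.1 hω
      simp only [indicator_of_notMem hω, mul_zero]
      linarith

theorem unique (hf : m.HasIntegral f I) (hg : m.HasIntegral f J) : I = J := by
  have h : ∀ ε : ℝ, 0 < ε → m.toFun {ω | f ω + ε < f ω} = 0 := fun ε hε => by
    rw [show {ω | f ω + ε < f ω} = ∅ from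
      eq_empty_of_forall_notMem fun ω (hω : f ω + ε < f ω) => by linarith, m.empty]
  exact le_antisymm (hg.le hf h) (hf.le hg h)

theorem integral_eq (hf : m.HasIntegral f I) : m.integral f = I := by
  have h : m.Integrable f := ⟨I, hf⟩
  rw [FinAddProb.integral, dif_pos h]
  exact (Classical.choose_spec h).unique hf

theorem add (hf : m.HasIntegral f I) (hg : m.HasIntegral g J) :
    m.HasIntegral (f + g) (I + J) := by
  obtain ⟨s, hs, hsm, hsc, hsI⟩ := hf
  obtain ⟨t, ht, htm, htc, htJ⟩ := hg
  refine ⟨fun n => s n + t n, fun n => (hs n).range_map₂ (ht n) fun x y => x + y,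
    fun ε hε => ?_, fun ε hε => ?_, ?_⟩
  · have h2 : 0 < ε / 2 := by positivity
    have hl := (hsm _ h2).add (htm _ h2)
    rw [add_zero] at hl
    refine squeeze_zero (fun n => m.nonneg' _) (fun n => ?_) hl
    refine (m.mono fun ω hω => ?_).trans (m.union_le _ _)
    by_contra hcon
    simp only [mem_union, mem_ofPred_eq, not_or, not_lt] at hcon
    have hω' : ε < |(s n + t n) ω - (f + g) ω| := hω
    have : (s n + t n) ω - (f + g) ω = (s n ω - f ω) + (t n ω - g ω) := by
      simp only [Pi.add_apply]; ring
    rw [this] at hω'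
    linarith [abs_add_le (s n ω - f ω) (t n ω - g ω)]
  · obtain ⟨N₁, hN₁⟩ := hsc (ε / 2) (by positivity)
    obtain ⟨N₂, hN₂⟩ := htc (ε / 2) (by positivity)
    refine ⟨max N₁ N₂, fun n hn k hk => ?_⟩
    have h1 := hN₁ n ((le_max_left _ _).trans hn) k ((le_max_left _ _).trans hk)
    have h2 := hN₂ n ((le_max_right _ _).trans hn) k ((le_max_right _ _).trans hk)
    have fs : (range |s n - s k|).Finite := (hs n).range_map₂ (hs k) fun x y => |x - y|
    have ft : (range |t n - t k|).Finite := (ht n).range_map₂ (ht k) fun x y => |x - y|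
    have fst : ∀ n, (range (s n + t n)).Finite := fun n => (hs n).range_map₂ (ht n) fun x y => x + y
    have := simpleIntegral_mono (m := m) ((fst n).range_map₂ (fst k) fun x y => |x - y|)
      (fs.range_map₂ ft fun x y => x + y) (fun ω => ?_)
    · have e := simpleIntegral_add (m := m) fs ft
      refine (this.trans_eq e).trans_lt (by linarith)
    · refine le_of_eq_of_le (congrArg abs ?_) (abs_add_le (s n ω - s k ω) (t n ω - t k ω))
      simp only [Pi.add_apply]
      ring
  · refine (hsI.add htJ).congr fun n => (simpleIntegral_add (hs n) (ht n)).symm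

theorem const (c : ℝ) : m.HasIntegral (constFun Ω c) c := by
  refine ⟨fun _ => constFun Ω c, fun _ => (finite_range_indicator (∅ : Set Ω)).range_map fun _ => c,
    fun ε hε => ?_, fun ε hε => ⟨0, fun n _ k _ => ?_⟩, ?_⟩
  · simp [not_lt.2 hε.le, m.empty]
  · have := simpleIntegral_const (m := m) 0
    refine lt_of_eq_of_lt (Eq.trans (congrArg _ ?_) this) hε
    ext ω
    simp
  · exact tendsto_const_nhds.congr fun _ => (simpleIntegral_const c).symm

theorem smul (hf : m.HasIntegral f I) {c : ℝ} (hc : 0 < c) : m.HasIntegral (c • f) (c * I) := by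
  obtain ⟨s, hs, hsm, hsc, hsI⟩ := hf
  refine ⟨fun n => c • s n, fun n => (hs n).range_map fun x => c * x,
    fun ε hε => ?_, fun ε hε => ?_, ?_⟩
  · refine (hsm (ε / c) (by positivity)).congr fun n => congrArg _ ?_
    ext ω
    simp only [mem_ofPred_eq, Pi.smul_apply, smul_eq_mul, ← mul_sub, abs_mul, abs_of_pos hc,
      div_lt_iff₀' hc]
  · obtain ⟨N, hN⟩ := hsc (ε / c) (by positivity)
    refine ⟨N, fun n hn k hk => ?_⟩
    have fs : (range |s n - s k|).Finite := (hs n).range_map₂ (hs k) fun x y => |x - y|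
    have e : |c • s n - c • s k| = c • |s n - s k| := by
      ext ω
      simp only [Pi.abs_apply, Pi.sub_apply, Pi.smul_apply, smul_eq_mul, ← mul_sub, abs_mul,
        abs_of_pos hc]
    rw [e, simpleIntegral_smul fs, ← lt_div_iff₀' hc]
    exact hN n hn k hk
  · exact (hsI.const_mul c).congr fun n => (simpleIntegral_smul (hs n) c).symm

end HasIntegral

theorem Integrable.hasIntegral {f : Ω → ℝ} (h : m.Integrable f) :
    m.HasIntegral f (m.integral f) := by
  obtain ⟨I, hI⟩ := h
  rwa [hI.integral_eq]

end FinAddProb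

/-! ### From positive functionals to finitely additive probabilities. -/

/-- Raising the truncation level moves `x` only by the part of `|x|` between the two levels. This
bounds oscillations of the truncations of `g` by increments of a monotone sequence. -/
theorem abs_clamp_sub_clamp_le {x k n : ℝ} (hk : 0 ≤ k) (hn : k ≤ n) :
    |max (min x n) (-n) - max (min x k) (-k)| ≤ min |x| n - min |x| k := by
  simp only [abs, max_def, min_def]
  split_ifs <;> linarith

theorem finite_range_floor_div {Ω : Type*} {h : Ω → ℝ} {M : ℝ} (hM : ∀ ω, |h ω| ≤ M) (c : ℝ) :
    (range fun ω => (⌊h ω⌋ : ℝ) / c).Finite := by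
  refine ((finite_Icc ⌊-M⌋ ⌊M⌋).image fun z : ℤ => (z : ℝ) / c).subset
    (range_subset_iff.2 fun ω => ⟨⌊h ω⌋, ⟨?_, ?_⟩, rfl⟩)
  · exact Int.floor_le_floor (abs_le.1 (hM ω)).1
  · exact Int.floor_le_floor (abs_le.1 (hM ω)).2

namespace FinAddProb

variable {Ω : Type*}

/-- The finitely additive probability induced by a linear functional which is positive on a solid
space of functions containing the constants. -/
noncomputable def ofLinear (φ : (Ω → ℝ) →ₗ[ℝ] ℝ) (hφ1 : φ 1 = 1)
    (hφ : ∀ A : Set Ω, 0 ≤ φ (A.indicator 1)) : FinAddProb Ω where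
  toFun A := φ (A.indicator 1)
  nonneg' := hφ
  univ' := by simpa using hφ1
  union' A B h := by rw [indicator_union_of_disjoint h, ← map_add]; rfl

variable {φ : (Ω → ℝ) →ₗ[ℝ] ℝ} {hφ1 : φ 1 = 1} {hφ : ∀ A : Set Ω, 0 ≤ φ (A.indicator 1)}

theorem simpleIntegral_ofLinear {s : Ω → ℝ} (hs : (range s).Finite) :
    (ofLinear φ hφ1 hφ).simpleIntegral s = φ s := by
  classical
  have h := (ofLinear φ hφ1 hφ).simpleIntegral_comp s hs.toFinset (by simp) id
  refine h.trans ?_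
  have : s = ∑ y ∈ hs.toFinset, y • (s ⁻¹' {y}).indicator (1 : Ω → ℝ) := by
    ext ω
    rw [Finset.sum_apply, Finset.sum_eq_single (s ω)]
    · simp
    · intro y _ hy
      simp [indicator_of_notMem, Ne.symm hy]
    · simp
  conv_rhs => rw [this, map_sum]
  refine Finset.sum_congr rfl fun y _ => ?_
  rw [map_smul]
  rfl

/-- The functions of a solid space on which `φ` is positive are integrable for the induced
probability, and `φ` dominates the integral of those bounded below. -/
theorem exists_hasIntegral_ofLinear {V : Submodule ℝ (Ω → ℝ)} (h1V : (1 : Ω → ℝ) ∈ V)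
    (hsolid : ∀ g ∈ V, ∀ h : Ω → ℝ, (∀ ω, |h ω| ≤ |g ω|) → h ∈ V)
    (hpos : ∀ g ∈ V, (∀ ω, 0 ≤ g ω) → 0 ≤ φ g) {g : Ω → ℝ} (hg : g ∈ V) :
    ∃ I : ℝ, (ofLinear φ hφ1 hφ).HasIntegral g I ∧
      (∀ a : ℝ, (∀ ω, a ≤ g ω) → I ≤ φ g) ∧ ∀ b : ℝ, (∀ ω, g ω ≤ b) → φ g ≤ I := by
  have hmono : ∀ f ∈ V, ∀ h ∈ V, (∀ ω, f ω ≤ h ω) → φ f ≤ φ h := fun f hf h hh hle => by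
    have := hpos _ (V.sub_mem hh hf) fun ω => sub_nonneg.2 (hle ω)
    rwa [map_sub, sub_nonneg] at this
  have hbdd : ∀ (h : Ω → ℝ) (C : ℝ), (∀ ω, |h ω| ≤ C) → h ∈ V := fun h C hC =>
    hsolid _ (V.smul_mem C h1V) h fun ω => (hC ω).trans (by simpa using le_abs_self C)
  have hφc : ∀ c : ℝ, φ (fun _ => c) = c := fun c => by
    have : (fun _ : Ω => c) = c • (1 : Ω → ℝ) := by ext; simp
    rw [this, map_smul, hφ1, smul_eq_mul, mul_one]
  have hcV : ∀ c : ℝ, (fun _ : Ω => c) ∈ V := fun c => hbdd _ |c| fun _ => le_rfl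
  have habs : |g| ∈ V := hsolid g hg _ fun ω => by simp
  set q : ℕ → Ω → ℝ := fun n ω => max (min (g ω) n) (-n) with hq
  have hqn : ∀ n ω, |q n ω| ≤ n := fun n ω => by
    have hn : (0 : ℝ) ≤ n := n.cast_nonneg
    exact abs_le.2 ⟨le_max_right _ _, max_le (min_le_right _ _) (by linarith)⟩
  -- Truncate at `±n`, then round down to the grid of mesh `1/(n+1)`.
  set s : ℕ → Ω → ℝ := fun n ω => (⌊q n ω * (n + 1)⌋ : ℝ) / (n + 1) with hs
  have hsf : ∀ n, (range (s n)).Finite := fun n =>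
    finite_range_floor_div (M := (n : ℝ) * (n + 1)) (fun ω => by
      rw [abs_mul, abs_of_pos (n.cast_add_one_pos : (0 : ℝ) < n + 1)]
      exact mul_le_mul_of_nonneg_right (hqn n ω) n.cast_add_one_pos.le) _
  have hs_le : ∀ n ω, s n ω ≤ q n ω := fun n ω =>
    (div_le_iff₀ n.cast_add_one_pos).2 (Int.floor_le _)
  have hle_s : ∀ n ω, q n ω ≤ s n ω + 1 / (n + 1) := fun n ω => by
    rw [hs]
    simp only
    rw [← add_div, le_div_iff₀ n.cast_add_one_pos]
    exact (Int.lt_floor_add_one _).le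
  have hfV : ∀ t : Ω → ℝ, (range t).Finite → t ∈ V := fun t ht => by
    obtain ⟨M, -, hM⟩ := ht.exists_abs_le
    exact hbdd t M hM
  set u : ℕ → Ω → ℝ := fun n ω => min |g ω| n with hu
  have huV : ∀ n, u n ∈ V := fun n => hbdd _ n fun ω => by
    rw [abs_of_nonneg (le_min (abs_nonneg _) n.cast_nonneg)]
    exact min_le_right _ _
  -- The numbers `φ(|g| ∧ n)` increase and are bounded by `φ(|g|)`, hence converge; this replaces
  -- countable additivity in the Cauchy estimate.
  have humono : Monotone fun n => φ (u n) := fun n k hnk =>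
    hmono _ (huV n) _ (huV k) fun ω => min_le_min_left _ (Nat.cast_le.2 hnk)
  have hulim := tendsto_atTop_ciSup humono ⟨φ |g|, by
    rintro _ ⟨n, rfl⟩
    exact hmono _ (huV n) _ habs fun ω => min_le_left _ _⟩
  have hcauchy : ∀ ε : ℝ, 0 < ε → ∃ N : ℕ, ∀ n ≥ N, ∀ k ≥ N, φ |s n - s k| < ε := by
    intro ε hε
    obtain ⟨N₁, hN₁⟩ := Metric.cauchySeq_iff'.1 hulim.cauchySeq (ε / 8) (by positivity)
    obtain ⟨N₂, hN₂⟩ := exists_nat_one_div_lt (show (0 : ℝ) < ε / 8 by positivity)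
    set N := max N₁ N₂
    have hN : ∀ n ≥ N, φ (u n) - φ (u N) < ε / 4 := fun n hn => by
      have e1 := (abs_lt.1 (hN₁ n ((le_max_left _ _).trans hn))).2
      have e2 := (abs_lt.1 (hN₁ N (le_max_left _ _))).1
      linarith
    have hNs : ∀ n ≥ N, ∀ ω, |s n ω - q n ω| ≤ ε / 8 := fun n hn ω => by
      have : (1 : ℝ) / (n + 1) ≤ 1 / (N₂ + 1) :=
        one_div_le_one_div_of_le N₂.cast_add_one_pos
          (by have : (N₂ : ℝ) ≤ n := Nat.cast_le.2 ((le_max_right _ _).trans hn)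
              linarith)
      exact abs_le.2 ⟨by linarith [hle_s n ω], by linarith [hs_le n ω]⟩
    refine ⟨N, fun n hn k hk => ?_⟩
    have := hmono |s n - s k| (hfV _ ((hsf n).range_map₂ (hsf k) fun x y => |x - y|))
      ((u n - u N) + (u k - u N) + fun _ => ε / 4)
      (V.add_mem (V.add_mem (V.sub_mem (huV _) (huV _)) (V.sub_mem (huV _) (huV _))) (hcV _))
      fun ω => ?_
    · rw [map_add, map_add, map_sub, map_sub, hφc] at this
      linarith [hN n hn, hN k hk]
    · have e1 := abs_clamp_sub_clamp_le (x := g ω) N.cast_nonneg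
        (Nat.cast_le (α := ℝ).2 hn)
      have e2 := abs_clamp_sub_clamp_le (x := g ω) N.cast_nonneg
        (Nat.cast_le (α := ℝ).2 hk)
      have e3 := abs_le.1 (hNs n hn ω)
      have e4 := abs_le.1 (hNs k hk ω)
      change |q n ω - q N ω| ≤ u n ω - u N ω at e1
      change |q k ω - q N ω| ≤ u k ω - u N ω at e2
      have e1' := abs_le.1 e1
      have e2' := abs_le.1 e2
      change |s n ω - s k ω| ≤ (u n ω - u N ω) + (u k ω - u N ω) + ε / 4
      exact abs_le.2 ⟨by linarith, by linarith⟩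
  have hcs : CauchySeq fun n => φ (s n) := by
    refine Metric.cauchySeq_iff.2 fun ε hε => ?_
    obtain ⟨N, hN⟩ := hcauchy ε hε
    refine ⟨N, fun n hn k hk => (abs_lt.2 ⟨?_, ?_⟩ : |φ (s n) - φ (s k)| < ε)⟩
    · have := hmono (s k - s n) (V.sub_mem (hfV _ (hsf k)) (hfV _ (hsf n))) |s k - s n|
        (hfV _ ((hsf k).range_map₂ (hsf n) fun x y => |x - y|)) fun ω => le_abs_self _
      rw [map_sub] at this
      linarith [hN k hk n hn]
    · have := hmono (s n - s k) (V.sub_mem (hfV _ (hsf n)) (hfV _ (hsf k))) |s n - s k|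
        (hfV _ ((hsf n).range_map₂ (hsf k) fun x y => |x - y|)) fun ω => le_abs_self _
      rw [map_sub] at this
      linarith [hN n hn k hk]
  obtain ⟨I, hI⟩ := cauchySeq_tendsto_of_complete hcs
  refine ⟨I, ⟨s, hsf, fun ε hε => ?_, fun ε hε => ?_, ?_⟩, fun a ha => ?_, fun b hb => ?_⟩
  -- Chebyshev: `s n` is within `1/(n+1)` of `g` except where `|g| > n`, a set of mass at most
  -- `φ(|g|)/n`.
  · refine squeeze_zero' (Eventually.of_forall fun n => (ofLinear φ hφ1 hφ).nonneg' _) ?_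
      (tendsto_const_div_atTop_nhds_zero_nat (φ |g|))
    obtain ⟨N, hN⟩ := exists_nat_one_div_lt hε
    filter_upwards [eventually_ge_atTop (N + 1)] with n hn
    have hn0 : (0 : ℝ) < n := Nat.cast_pos.2 (by omega)
    have hnε : (1 : ℝ) / (n + 1) < ε := (one_div_le_one_div_of_le N.cast_add_one_pos
      (by have : ((N + 1 : ℕ) : ℝ) ≤ n := Nat.cast_le.2 hn
          push_cast at this
          linarith)).trans_lt hN
    refine ((ofLinear φ hφ1 hφ).mono (B := {ω | (n : ℝ) < |g ω|}) fun ω hω => ?_).trans ?_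
    · by_contra hcon
      have hcon' : |g ω| ≤ n := not_lt.1 hcon
      have hω' : ε < |s n ω - g ω| := hω
      have hqg : q n ω = g ω := by
        have := abs_le.1 hcon'
        rw [hq]
        simp only
        rw [min_eq_left this.2, max_eq_left this.1]
      have e1 := hs_le n ω
      have e2 := hle_s n ω
      rw [hqg] at e1 e2
      exact absurd hω' (not_lt.2 (abs_le.2 ⟨by linarith, by linarith⟩))
    · rw [le_div_iff₀ hn0, mul_comm]
      have := hmono ((n : ℝ) • {ω | (n : ℝ) < |g ω|}.indicator 1)
        (hfV _ ((finite_range_indicator _).range_map fun x => n * x)) |g| habs fun ω => ?_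
      · rwa [map_smul, smul_eq_mul] at this
      · by_cases hω : ω ∈ {ω | (n : ℝ) < |g ω|}
        · simp only [Pi.smul_apply, indicator_of_mem hω, Pi.one_apply, smul_eq_mul, mul_one]
          exact le_of_lt hω
        · simp [indicator_of_notMem hω]
  · obtain ⟨N, hN⟩ := hcauchy ε hε
    refine ⟨N, fun n hn k hk => ?_⟩
    have := simpleIntegral_ofLinear (hφ1 := hφ1) (hφ := hφ)
      ((hsf n).range_map₂ (hsf k) fun x y => |x - y|)
    exact this.trans_lt (hN n hn k hk)
  · exact hI.congr fun n => (simpleIntegral_ofLinear (hsf n)).symm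
  -- For `n ≥ -a` the lower truncation is inactive, so `s n ≤ q n ≤ g`.
  · obtain ⟨N, hN⟩ := exists_nat_ge (-a)
    refine le_of_tendsto hI ((eventually_ge_atTop N).mono fun n hn => ?_)
    refine hmono _ (hfV _ (hsf n)) _ hg fun ω => (hs_le n ω).trans (max_le (min_le_left _ _) ?_)
    have : (N : ℝ) ≤ n := Nat.cast_le.2 hn
    linarith [ha ω]
  · obtain ⟨N, hN⟩ := exists_nat_ge b
    have hlim := hI.add (tendsto_one_div_add_atTop_nhds_zero_nat (𝕜 := ℝ))
    rw [add_zero] at hlim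
    refine ge_of_tendsto hlim ((eventually_ge_atTop N).mono fun n hn => ?_)
    have := hmono _ hg (s n + fun _ => 1 / ((n : ℝ) + 1)) (V.add_mem (hfV _ (hsf n)) (hcV _))
      fun ω => le_trans ?_ (hle_s n ω)
    · rwa [map_add, hφc] at this
    · have : (N : ℝ) ≤ n := Nat.cast_le.2 hn
      exact le_max_of_le_left (le_min le_rfl (by linarith [hb ω]))

end FinAddProb

/-- M. Riesz extension: a point `g` outside a convex cone `C` which has `e` as an order unit can be
separated from `C` by a linear functional normalised at `e`. -/
theorem exists_linear_nonpos_on_cone {E : Type*} [AddCommGroup E] [Module ℝ E]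
    (V : Submodule ℝ E) {C : Set E} (h0 : (0 : E) ∈ C) (hadd : ∀ x ∈ C, ∀ y ∈ C, x + y ∈ C)
    (hsmul : ∀ c : ℝ, 0 < c → ∀ x ∈ C, c • x ∈ C) {e g : E} (heV : e ∈ V) (heC : -e ∈ C)
    (he : e ∉ C) (hgV : g ∈ V) (hg : g ∉ C) (hunit : ∀ v ∈ V, ∃ t : ℝ, v - t • e ∈ C) :
    ∃ φ : E →ₗ[ℝ] ℝ, φ e = 1 ∧ (∀ v ∈ V, v ∈ C → φ v ≤ 0) ∧ 0 ≤ φ g := by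
  have hsmul0 : ∀ c : ℝ, 0 ≤ c → ∀ x ∈ C, c • x ∈ C := fun c hc x hx => by
    rcases hc.eq_or_lt with rfl | hc
    · simpa using h0
    · exact hsmul c hc x hx
  -- The cone generated by `-C ∩ V` (take `r = 0`) and `g`, enlarged by whatever `C` absorbs;
  -- positivity on it is the required conclusion.
  let s : PointedCone ℝ V :=
    { carrier := {v | ∃ r : ℝ, 0 ≤ r ∧ r • g - (v : E) ∈ C}
      zero_mem' := ⟨0, le_rfl, by simpa using h0⟩
      add_mem' := by
        rintro x y ⟨r, hr, hx⟩ ⟨q, hq, hy⟩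
        refine ⟨r + q, add_nonneg hr hq, ?_⟩
        have := hadd _ hx _ hy
        rwa [sub_add_sub_comm, ← add_smul] at this
      smul_mem' := by
        rintro ⟨c, hc⟩ x ⟨r, hr, hx⟩
        refine ⟨c * r, mul_nonneg hc hr, ?_⟩
        have := hsmul0 c hc _ hx
        rwa [smul_sub, smul_smul] at this }
  have he0 : (⟨e, heV⟩ : V) ≠ 0 := fun h => he (by
    have : e = 0 := congrArg Subtype.val h
    rwa [this])
  obtain ⟨ψ, hψ, hψs⟩ := riesz_extension s
    (LinearPMap.mkSpanSingleton (σ := RingHom.id ℝ) (⟨e, heV⟩ : V) (1 : ℝ) he0)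
    (by
      rintro ⟨x, hx⟩ hxs
      obtain ⟨t, rfl⟩ := Submodule.mem_span_singleton.1 hx
      rw [LinearPMap.mkSpanSingleton'_apply]
      simp only [RingHom.id_apply, smul_eq_mul, mul_one]
      -- If `t < 0` and `r g - t e ∈ C`, adding `(-t)(-e)` gives `r g ∈ C`. Then `g ∈ C` when `r >
      -- 0`, and `e ∈ C` when `r = 0`.
      by_contra! ht
      obtain ⟨r, hr, hrC⟩ := hxs
      have h1 := hadd _ hrC _ (hsmul (-t) (by linarith) _ heC)
      have h2 : r • g ∈ C := by
        convert h1 using 1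
        simp
      rcases hr.eq_or_lt with rfl | hr
      · have h3 := hsmul (-t)⁻¹ (inv_pos.2 (by linarith)) _ hrC
        refine he ?_
        convert h3 using 1
        simp only [zero_smul, zero_sub, Submodule.coe_smul, ← neg_smul, smul_smul]
        rw [inv_mul_cancel₀ (by linarith), one_smul]
      · have h3 := hsmul r⁻¹ (inv_pos.2 hr) _ h2
        rw [smul_smul, inv_mul_cancel₀ hr.ne', one_smul] at h3
        exact hg h3)
    (fun y => by
      obtain ⟨t, ht⟩ := hunit (-(y : E)) (V.neg_mem y.2)
      refine ⟨⟨t • ⟨e, heV⟩, Submodule.mem_span_singleton.2 ⟨t, rfl⟩⟩, 0, le_rfl, ?_⟩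
      convert ht using 1
      simp only [zero_smul, Submodule.coe_add, Submodule.coe_smul]
      abel)
  obtain ⟨φ, hφ⟩ := ψ.exists_extend
  have hφV : ∀ v (hv : v ∈ V), φ v = ψ ⟨v, hv⟩ := fun v hv => LinearMap.congr_fun hφ ⟨v, hv⟩
  refine ⟨φ, ?_, fun v hv hvC => ?_, ?_⟩
  · rw [hφV e heV]
    exact (hψ ⟨⟨e, heV⟩, Submodule.mem_span_singleton_self _⟩).trans
      (LinearPMap.mkSpanSingleton_apply _ _ he0 1)
  · have := hψs ⟨-v, V.neg_mem hv⟩ ⟨0, le_rfl, by simpa using hvC⟩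
    rw [← hφV, map_neg] at this
    linarith
  · rw [hφV g hgV]
    exact hψs _ ⟨1, zero_le_one, by simpa using h0⟩

theorem mem_uniformClosure_iff {Ω : Type*} {A : Set (Ω → ℝ)} {f : Ω → ℝ} :
    f ∈ uniformClosure A ↔ ∀ ε : ℝ, 0 < ε → ∃ g ∈ A, ∀ ω, |g ω - f ω| < ε := by
  unfold uniformClosure
  rw [mem_ofPred_eq, mem_closure_iff_nhds_basis
    (UniformFun.hasBasis_nhds_of_basis Ω ℝ _ Metric.uniformity_basis_dist)]
  simp only [exists_mem_image]
  refine forall₂_congr fun ε _ => exists_congr fun g => and_congr_right fun _ =>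
    forall_congr' fun ω => ?_
  rw [← Real.dist_eq, dist_comm]
  rfl

/-! ### The space `L(𝒳)` and the truncated payoffs. -/

namespace IsAssetSet

variable {Ω : Type*} {ge : (Ω → ℝ) → (Ω → ℝ) → Prop} {𝒳 : Set (Ω → ℝ)}

theorem smul_mem (h𝒳 : IsAssetSet ge 𝒳) {X : Ω → ℝ} (hX : X ∈ 𝒳) {c : ℝ} (hc0 : 0 ≤ c)
    (hc1 : c ≤ 1) : c • X ∈ 𝒳 :=
  h𝒳.convex.smul_mem_of_zero_mem h𝒳.zero_mem hX ⟨hc0, hc1⟩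

/-- A positive combination of payoffs is a multiple of a payoff, priced no higher than the
combination of the prices. -/
theorem exists_combination (h𝒳 : IsAssetSet ge 𝒳) {X Y : Ω → ℝ} (hX : X ∈ 𝒳) (hY : Y ∈ 𝒳)
    {c d : ℝ} (hc : 0 < c) (hd : 0 < d) :
    ∃ Z ∈ 𝒳, (c + d) • Z = c • X + d • Y ∧ ∀ π : (Ω → ℝ) → ℝ, IsPriceFunction ge 𝒳 π →
      (c + d) * π Z ≤ c * π X + d * π Y := by
  have hcd : 0 < c + d := add_pos hc hd
  -- Since `𝒳` is convex but need not be a cone, the weights are normalised; the scaled payoffs stay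
  -- in `𝒳` because `0 ∈ 𝒳`.
  have hsum : c / (c + d) + d / (c + d) = 1 := by field_simp
  have ha : 0 ≤ c / (c + d) := by positivity
  have hb : 0 ≤ d / (c + d) := by positivity
  have hZ := h𝒳.convex hX hY ha hb hsum
  have hXm := h𝒳.smul_mem hX ha (by linarith)
  have hYm := h𝒳.smul_mem hY hb (by linarith)
  refine ⟨_, hZ, ?_, fun π hπ => ?_⟩
  · rw [smul_add, smul_smul, smul_smul, mul_div_cancel₀ _ hcd.ne', mul_div_cancel₀ _ hcd.ne']
  · have h := hπ.subadditive _ hXm _ hYm hZ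
    rw [hπ.pos_homogeneous _ hX _ ha hXm, hπ.pos_homogeneous _ hY _ hb hYm] at h
    refine (mul_le_mul_of_nonneg_left h hcd.le).trans_eq ?_
    field_simp

/-- `L(𝒳)` as a vector space. -/
def completeSubmodule (hge : IsCommonOrder ge) (h𝒳 : IsAssetSet ge 𝒳) :
    Submodule ℝ (Ω → ℝ) where
  carrier := completeAssets ge 𝒳
  zero_mem' := ⟨1, one_pos, 0, h𝒳.zero_mem, by simpa using hge.refl 0⟩
  add_mem' := by
    rintro f g ⟨c, hc, X, hX, hf⟩ ⟨d, hd, Y, hY, hg⟩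
    obtain ⟨Z, hZ, hZe, -⟩ := h𝒳.exists_combination hX hY hc hd
    refine ⟨c + d, add_pos hc hd, Z, hZ, ?_⟩
    rw [hZe]
    exact hge.mono (hge.add hf hg) (fun _ => le_rfl) fun ω => abs_add_le _ _
  smul_mem' := by
    rintro a f ⟨c, hc, X, hX, hf⟩
    rcases eq_or_ne a 0 with rfl | ha
    · exact ⟨1, one_pos, 0, h𝒳.zero_mem, by simpa using hge.refl 0⟩
    · refine ⟨|a| * c, mul_pos (abs_pos.2 ha) hc, X, hX, ?_⟩
      have := hge.smul hf (abs_nonneg a)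
      rw [smul_smul] at this
      exact hge.mono this (fun _ => le_rfl) fun ω => by simp [abs_mul]

theorem one_mem_complete (hge : IsCommonOrder ge) (h𝒳 : IsAssetSet ge 𝒳) :
    (1 : Ω → ℝ) ∈ completeAssets ge 𝒳 :=
  ⟨1, one_pos, 1, h𝒳.one_mem, hge.of_le _ _ fun ω => by simp⟩

theorem complete_of_abs_le (hge : IsCommonOrder ge) {g h : Ω → ℝ} (hg : g ∈ completeAssets ge 𝒳)
    (hh : ∀ ω, |h ω| ≤ |g ω|) : h ∈ completeAssets ge 𝒳 := by
  obtain ⟨c, hc, X, hX, hX'⟩ := hg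
  exact ⟨c, hc, X, hX, hge.mono hX' (fun _ => le_rfl) hh⟩

theorem const_mem_complete (hge : IsCommonOrder ge) (h𝒳 : IsAssetSet ge 𝒳) (a : ℝ) :
    constFun Ω a ∈ completeAssets ge 𝒳 := by
  have := (completeSubmodule hge h𝒳).smul_mem a (one_mem_complete hge h𝒳)
  refine complete_of_abs_le hge this fun ω => ?_
  simp [constFun]

/-- Where `X ≥ a`, `|X| ≤ X + 2|a|` pointwise. On `{X < a}` the inequality is restored by `1_{X<a}
(X - a) ≥_* 0`, used twice because `|X| - X` can be as large as `-2X`. -/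
theorem mem_complete (hge : IsCommonOrder ge) (h𝒳 : IsAssetSet ge 𝒳) {X : Ω → ℝ}
    (hX : X ∈ 𝒳) : X ∈ completeAssets ge 𝒳 := by
  obtain ⟨a, ha⟩ := h𝒳.bounded_below X hX
  refine ⟨1, one_pos, _, h𝒳.add_const_mem X hX (2 * |a|) (by positivity), ?_⟩
  have h1 := hge.sub_nonneg ha
  have h2 := hge.mul_left h1 (b := {ω | X ω < a}.indicator 1) (C := 1)
    (fun ω => indicator_nonneg (fun _ _ => zero_le_one) ω)
    (fun ω => indicator_le_self' (fun _ _ => zero_le_one) ω)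
  have h3 := hge.add_right (hge.add h2 h2) |X|
  refine hge.mono h3 (fun ω => ?_) (fun ω => by simp)
  by_cases hω : X ω < a
  · have : ω ∈ {ω | X ω < a} := hω
    simp only [Pi.add_apply, Pi.mul_apply, indicator_of_mem this, Pi.one_apply, one_mul,
      Pi.sub_apply, Pi.abs_apply, constFun, one_smul]
    rcases abs_cases (X ω) with h | h <;> rcases abs_cases a with h' | h' <;> linarith
  · have : ω ∉ {ω | X ω < a} := hω
    simp only [Pi.add_apply, Pi.mul_apply, indicator_of_notMem this, zero_mul,
      Pi.abs_apply, constFun, one_smul]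
    rcases abs_cases (X ω) with h | h <;> rcases abs_cases a with h' | h' <;> linarith

theorem inf_const_mem_complete (hge : IsCommonOrder ge) {f : Ω → ℝ} (hf : f ∈ completeAssets ge 𝒳)
    {k : ℝ} (hk : 0 ≤ k) :
    f ⊓ constFun Ω k ∈ completeAssets ge 𝒳 := by
  refine complete_of_abs_le hge hf fun ω => ?_
  simp only [Pi.inf_apply, constFun]
  rcases le_total (f ω) k with h | h
  · rw [inf_eq_left.2 h]
  · rw [inf_eq_right.2 h]
    exact abs_le_abs_of_nonneg hk h

theorem truncated_mem_complete (hge : IsCommonOrder ge) (h𝒳 : IsAssetSet ge 𝒳)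
    {f : Ω → ℝ} (hf : f ∈ truncatedAssets 𝒳) :
    f ∈ completeAssets ge 𝒳 := by
  rcases hf with hf | ⟨X, hX, k, hk, rfl⟩
  · exact mem_complete hge h𝒳 hf
  · exact inf_const_mem_complete hge (mem_complete hge h𝒳 hX) hk

theorem truncated_smul_mem (h𝒳 : IsAssetSet ge 𝒳) {f : Ω → ℝ}
    (hf : f ∈ truncatedAssets 𝒳) {c : ℝ} (hc0 : 0 ≤ c)
    (hc1 : c ≤ 1) : c • f ∈ truncatedAssets 𝒳 := by
  rcases hf with hf | ⟨X, hX, k, hk, rfl⟩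
  · exact Or.inl (h𝒳.smul_mem hf hc0 hc1)
  · refine Or.inr ⟨_, h𝒳.smul_mem hX hc0 hc1, c * k, mul_nonneg hc0 hk, ?_⟩
    ext ω
    simp [constFun, mul_min_of_nonneg _ _ hc0]

theorem truncated_add_const_mem (h𝒳 : IsAssetSet ge 𝒳) {f : Ω → ℝ}
    (hf : f ∈ truncatedAssets 𝒳) {a : ℝ} (ha : 0 ≤ a) :
    f + constFun Ω a ∈ truncatedAssets 𝒳 := by
  rcases hf with hf | ⟨X, hX, k, hk, rfl⟩
  · exact Or.inl (h𝒳.add_const_mem _ hf _ ha)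
  · refine Or.inr ⟨_, h𝒳.add_const_mem _ hX _ ha, k + a, add_nonneg hk ha, ?_⟩
    ext ω
    simp [constFun, min_add_add_right]

end IsAssetSet

namespace IsPriceFunction

variable {Ω : Type*} {ge : (Ω → ℝ) → (Ω → ℝ) → Prop} {𝒳 : Set (Ω → ℝ)} {π : (Ω → ℝ) → ℝ}

theorem map_zero {S : Set (Ω → ℝ)} (hπ : IsPriceFunction ge S π) (h0 : (0 : Ω → ℝ) ∈ S) :
    π 0 = 0 := by
  simpa using hπ.pos_homogeneous 0 h0 0 le_rfl (by simpa using h0)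

end IsPriceFunction

/-! ### The price cone, and (i) implies (ii). -/

section PriceCone

variable {Ω : Type*} {ge : (Ω → ℝ) → (Ω → ℝ) → Prop} {𝒳 : Set (Ω → ℝ)} {π : (Ω → ℝ) → ℝ}

theorem priceCone_of_ge (hge : IsCommonOrder ge) {f g : Ω → ℝ} (hf : f ∈ priceCone ge 𝒳 π)
    (h : ge f g) : g ∈ priceCone ge 𝒳 π := by
  obtain ⟨c, hc, X, hX, hX'⟩ := hf
  exact ⟨c, hc, X, hX, hge.trans _ _ _ hX' h⟩

theorem zero_mem_priceCone (hge : IsCommonOrder ge) (h𝒳 : IsAssetSet ge 𝒳)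
    (hπ : IsPriceFunction ge 𝒳 π) : (0 : Ω → ℝ) ∈ priceCone ge 𝒳 π := by
  refine ⟨1, one_pos, 0, h𝒳.zero_mem, hge.of_le _ _ fun ω => ?_⟩
  simp [hπ.map_zero h𝒳.zero_mem, constFun]

theorem smul_mem_priceCone (hge : IsCommonOrder ge) {c : ℝ} (hc : 0 < c) {f : Ω → ℝ}
    (hf : f ∈ priceCone ge 𝒳 π) : c • f ∈ priceCone ge 𝒳 π := by
  obtain ⟨d, hd, X, hX, hX'⟩ := hf
  refine ⟨c * d, mul_pos hc hd, X, hX, ?_⟩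
  rw [← smul_smul]
  exact hge.smul hX' hc.le

theorem add_mem_priceCone (hge : IsCommonOrder ge) (h𝒳 : IsAssetSet ge 𝒳)
    (hπ : IsPriceFunction ge 𝒳 π) {f g : Ω → ℝ} (hf : f ∈ priceCone ge 𝒳 π)
    (hg : g ∈ priceCone ge 𝒳 π) : f + g ∈ priceCone ge 𝒳 π := by
  obtain ⟨c, hc, X, hX, hf⟩ := hf
  obtain ⟨d, hd, Y, hY, hg⟩ := hg
  obtain ⟨Z, hZ, hZe, hZπ⟩ := h𝒳.exists_combination hX hY hc hd
  refine ⟨c + d, add_pos hc hd, Z, hZ, hge.mono (hge.add hf hg) (fun ω => ?_) fun _ => le_rfl⟩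
  have h1 := hZπ π hπ
  have h2 := congrFun hZe ω
  simp only [Pi.add_apply, Pi.smul_apply, Pi.sub_apply, smul_eq_mul, constFun] at h2 ⊢
  linarith

theorem sub_price_mem_priceCone (hge : IsCommonOrder ge) {X : Ω → ℝ} (hX : X ∈ 𝒳) :
    X - constFun Ω (π X) ∈ priceCone ge 𝒳 π :=
  ⟨1, one_pos, X, hX, by simpa using hge.refl _⟩

theorem inf_one_mem_truncatedAssets {f : Ω → ℝ} (hf : f ∈ truncatedAssets 𝒳) :
    f ⊓ 1 ∈ truncatedAssets 𝒳 := by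
  rcases hf with hf | ⟨X, hX, k, hk, rfl⟩
  · exact Or.inr ⟨f, hf, 1, zero_le_one, rfl⟩
  · exact Or.inr ⟨X, hX, min k 1, le_min hk zero_le_one, by ext ω; simp [constFun, min_assoc]⟩

/-- A cash-additive extension keeps the limits of the price cone away from strictly positive
payoffs. -/
theorem notMem_uniformClosure_of_extension (hge : IsCommonOrder ge) (h𝒳 : IsAssetSet ge 𝒳)
    {π₁ : (Ω → ℝ) → ℝ} (h₁ : IsCashAdditiveExtension ge 𝒳 π (truncatedAssets 𝒳) π₁)
    {f : Ω → ℝ} (hf : f ∈ truncatedAssets 𝒳) (hf0 : StrictOf ge f 0) :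
    f ∉ uniformClosure (priceCone ge 𝒳 π) := by
  obtain ⟨hπ₁, hcash, hle⟩ := h₁
  intro hcl
  refine (hπ₁.no_arbitrage f hf hf0).not_ge (le_of_forall_pos_le_add fun ε hε => ?_)
  rw [zero_add]
  obtain ⟨g, ⟨c, hc, X, hX, hg⟩, hgf⟩ := mem_uniformClosure_iff.1 hcl ε hε
  -- the scaling factors `a`, `b` turn both sides of the comparison into payoffs
  obtain ⟨a, b, ha0, ha1, hb0, hb1, hb, hab⟩ : ∃ a b : ℝ, 0 ≤ a ∧ a ≤ 1 ∧ 0 ≤ b ∧ b ≤ 1 ∧ 0 < b ∧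
      b * c = a := by
    rcases le_total c 1 with h | h
    · exact ⟨c, 1, hc.le, h, zero_le_one, le_rfl, one_pos, one_mul c⟩
    · exact ⟨1, c⁻¹, zero_le_one, le_rfl, inv_nonneg.2 hc.le, inv_le_one_of_one_le₀ h,
        inv_pos.2 hc, inv_mul_cancel₀ hc.ne'⟩
  have hbf := h𝒳.truncated_smul_mem hf hb0 hb1
  have haX := h𝒳.smul_mem hX ha0 ha1
  -- Only nonnegative constants can be added within `𝒳₁`, so the positive and negative parts of `π
  -- X` go to opposite sides.
  have hp : 0 ≤ a * max (π X) 0 := mul_nonneg ha0 (le_max_right _ _)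
  have hn : 0 ≤ a * max (-π X) 0 + b * ε :=
    add_nonneg (mul_nonneg ha0 (le_max_right _ _)) (mul_nonneg hb0 hε.le)
  have hπX : a * max (π X) 0 - a * max (-π X) 0 = a * π X := by
    rw [← mul_sub, max_zero_sub_max_neg_zero_eq_self]
  have haX₁ : a • X ∈ truncatedAssets 𝒳 := Or.inl haX
  have hr := h𝒳.truncated_add_const_mem haX₁ hn
  have hl := h𝒳.truncated_add_const_mem hbf hp
  have hmain : ge (a • X + constFun Ω (a * max (-π X) 0 + b * ε))
      (b • f + constFun Ω (a * max (π X) 0)) := by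
    have h1 := hge.add_right (hge.smul hg hb0) (constFun Ω (a * max (π X) 0 + b * ε))
    refine hge.mono h1 (fun ω => ?_) fun ω => ?_
    · simp only [Pi.add_apply, Pi.smul_apply, Pi.sub_apply, smul_eq_mul, constFun]
      rw [← mul_assoc, hab]
      linarith
    · have h2 := mul_le_mul_of_nonneg_left (abs_lt.1 (hgf ω)).1.le hb0
      simp only [Pi.add_apply, Pi.smul_apply, smul_eq_mul, constFun]
      linarith
  have h2 := hπ₁.monotone _ hr _ hl hmain
  rw [hcash _ haX₁ _ hr, hcash _ hbf _ hl, hπ₁.pos_homogeneous _ hf _ hb0 hbf,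
    hπ₁.pos_homogeneous X (Or.inl hX) _ ha0 haX₁] at h2
  have h3 := mul_le_mul_of_nonneg_left (hle X hX) ha0
  exact le_of_mul_le_mul_left (by linarith) hb

end PriceCone

/-! ### Pricing measures: existence and upper envelope. -/

section PricingMeasures

variable {Ω : Type*} {ge : (Ω → ℝ) → (Ω → ℝ) → Prop} {𝒳 : Set (Ω → ℝ)} {π : (Ω → ℝ) → ℝ}

theorem integral_mono_of_mem_pricingMeasures (hge : IsCommonOrder ge) {m : FinAddProb Ω}
    (hm : m ∈ pricingMeasures ge 𝒳 π) {f g : Ω → ℝ} (hf : f ∈ completeAssets ge 𝒳)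
    (hg : g ∈ completeAssets ge 𝒳) (h : ge f g) : m.integral g ≤ m.integral f :=
  (hm.2.1 f hf).hasIntegral.le (hm.2.1 g hg).hasIntegral fun _ hε =>
    hm.1 _ (hge.negligible_of_ge h hε)

/-- If `f ∧ 1` is not a uniform limit of the price cone, some pricing measure charges it. -/
theorem exists_pricingMeasure_integral_pos (hge : IsCommonOrder ge) (h𝒳 : IsAssetSet ge 𝒳)
    (hπ : IsPriceFunction ge 𝒳 π) (h1C : (1 : Ω → ℝ) ∉ priceCone ge 𝒳 π) {v : Ω → ℝ}
    (hv : v ∈ completeAssets ge 𝒳) (hv1 : ∀ ω, v ω ≤ 1)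
    (hvC : v ∉ uniformClosure (priceCone ge 𝒳 π)) :
    ∃ m ∈ pricingMeasures ge 𝒳 π, 0 < m.integral v := by
  set C := priceCone ge 𝒳 π with hC
  let V := h𝒳.completeSubmodule hge
  have h1V : (1 : Ω → ℝ) ∈ V := h𝒳.one_mem_complete hge
  have hconst : ∀ a : ℝ, constFun Ω a = a • (1 : Ω → ℝ) := fun a => by ext; simp [constFun]
  obtain ⟨ε, hε, hεC⟩ : ∃ ε : ℝ, 0 < ε ∧ v - constFun Ω ε ∉ C := by
    by_contra! hcon
    refine hvC (mem_uniformClosure_iff.2 fun ε hε => ⟨_, hcon (ε / 2) (half_pos hε), fun ω => ?_⟩)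
    simp only [Pi.sub_apply, constFun, sub_sub_cancel_left, abs_neg]
    rw [abs_of_pos (half_pos hε)]
    exact half_lt_self hε
  have h0C := zero_mem_priceCone hge h𝒳 hπ
  obtain ⟨φ, hφ1, hφC, hφv⟩ := exists_linear_nonpos_on_cone V h0C
    (fun x hx y hy => add_mem_priceCone hge h𝒳 hπ hx hy)
    (fun c hc x hx => smul_mem_priceCone hge hc hx) h1V
    (priceCone_of_ge hge h0C (hge.of_le _ _ fun ω => by simp)) h1C
    (V.sub_mem hv (h𝒳.const_mem_complete hge ε)) hεC
    (fun g hg => by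
      -- From `cX ≥_* |g|` follows `c[X - π(X)] ≥_* g - cπ(X)`, so `t = cπ(X)` shows that `1` is an
      -- order unit.
      obtain ⟨c, hc, X, hX, hX'⟩ := hg
      refine ⟨c * π X, ?_⟩
      have h1 := smul_mem_priceCone hge hc (sub_price_mem_priceCone (π := π) hge hX)
      refine priceCone_of_ge hge h1 ?_
      refine hge.mono (hge.add_right hX' (constFun Ω (-(c * π X)))) (fun ω => ?_) fun ω => ?_
      · simp only [Pi.add_apply, Pi.smul_apply, Pi.sub_apply, smul_eq_mul, constFun]
        linarith
      · simp only [Pi.add_apply, Pi.smul_apply, Pi.sub_apply, smul_eq_mul, constFun,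
          Pi.abs_apply, Pi.one_apply]
        linarith [le_abs_self (g ω)])
  rw [map_sub, hconst, map_smul, hφ1, smul_eq_mul, mul_one, sub_nonneg] at hφv
  have hpos : ∀ g ∈ V, ge g 0 → 0 ≤ φ g := fun g hg h => by
    have h1 : ge 0 (-g) := by simpa using hge.add_right h (-g)
    have := hφC _ (V.neg_mem hg) (priceCone_of_ge hge h0C h1)
    rw [map_neg] at this
    linarith
  have hsolid : ∀ g ∈ V, ∀ h : Ω → ℝ, (∀ ω, |h ω| ≤ |g ω|) → h ∈ V := fun g hg h hle =>
    IsAssetSet.complete_of_abs_le hge hg hle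
  have hind : ∀ A : Set Ω, A.indicator (1 : Ω → ℝ) ∈ V := fun A => hsolid 1 h1V _ fun ω => by
    by_cases hω : ω ∈ A <;> simp [hω]
  have hφA : ∀ A : Set Ω, 0 ≤ φ (A.indicator 1) := fun A => hpos _ (hind A)
    (hge.of_le _ _ fun ω => indicator_nonneg (fun _ _ => zero_le_one) ω)
  set m := FinAddProb.ofLinear φ hφ1 hφA with hm
  have hint : ∀ g ∈ V, ∃ I : ℝ, m.HasIntegral g I ∧
      (∀ a : ℝ, (∀ ω, a ≤ g ω) → I ≤ φ g) ∧ ∀ b : ℝ, (∀ ω, g ω ≤ b) → φ g ≤ I := fun g hg =>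
    FinAddProb.exists_hasIntegral_ofLinear h1V hsolid
      (fun g hg h => hpos g hg (hge.of_le _ _ h)) hg
  have hnull : ∀ A ∈ negligibleSets ge, m.toFun A = 0 := fun A hA => by
    refine le_antisymm ?_ (m.nonneg' A)
    have := hφC _ (hind A) (priceCone_of_ge hge h0C hA)
    exact this
  refine ⟨m, ⟨hnull, fun g hg => ?_, fun X hX => ?_⟩, ?_⟩
  · obtain ⟨I, hI, -⟩ := hint g hg
    exact ⟨I, hI⟩
  · have hXV : X ∈ V := h𝒳.mem_complete hge hX
    obtain ⟨I, hI, -⟩ := hint X hXV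
    obtain ⟨a, ha⟩ := h𝒳.bounded_below X hX
    have ha' : ge (X - constFun Ω a) 0 := hge.sub_nonneg ha
    -- `X` is bounded below only for `≥_*`, whereas `∫ ≤ φ` needs a pointwise bound. As `X ≥_* X ∨
    -- a`, the chain is `∫ X ≤ ∫ (X ∨ a) ≤ φ(X ∨ a) ≤ φ(X) ≤ π(X)`.
    have hX' : X ⊔ constFun Ω a ∈ V := by
      refine hsolid (|X| + constFun Ω |a|) (V.add_mem (hsolid X hXV _ fun ω => by simp)
        (h𝒳.const_mem_complete hge _)) _ fun ω => ?_
      simp only [Pi.sup_apply, constFun, Pi.add_apply, Pi.abs_apply]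
      rw [abs_of_nonneg (add_nonneg (abs_nonneg (X ω)) (abs_nonneg a))]
      exact abs_max_le_max_abs_abs.trans
        (max_le (le_add_of_nonneg_right (abs_nonneg _)) (le_add_of_nonneg_left (abs_nonneg _)))
    obtain ⟨J, hJ, hJφ, -⟩ := hint _ hX'
    have hIJ : I ≤ J := hJ.le hI fun ε hε => by
      rw [show {ω | (X ⊔ constFun Ω a) ω + ε < X ω} = ∅ from
        eq_empty_of_forall_notMem fun ω (hω : (X ⊔ constFun Ω a) ω + ε < X ω) => by
          have : X ω ≤ (X ⊔ constFun Ω a) ω := le_max_left _ _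
          linarith, m.empty]
    have h1 := hge.mul_left ha' (b := {ω | X ω < a}.indicator 1) (C := 1)
      (fun ω => indicator_nonneg (fun _ _ => zero_le_one) ω)
      (fun ω => indicator_le_self' (fun _ _ => zero_le_one) ω)
    have h2 : ge (X - X ⊔ constFun Ω a) 0 := by
      refine hge.mono h1 (fun ω => ?_) fun ω => by simp
      by_cases hω : X ω < a
      · have hmem : ω ∈ {ω | X ω < a} := hω
        simp [indicator_of_mem hmem, constFun, max_eq_right hω.le]
      · have hmem : ω ∉ {ω | X ω < a} := hω
        simp [indicator_of_notMem hmem, constFun, max_eq_left (not_lt.1 hω)]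
    have h3 := hpos _ (V.sub_mem hXV hX') h2
    rw [map_sub] at h3
    have h4 := hJφ a fun ω => le_max_right _ _
    have h5 := hφC _ (V.sub_mem hXV (h𝒳.const_mem_complete hge _))
      (sub_price_mem_priceCone hge hX)
    rw [map_sub, hconst, map_smul, hφ1, smul_eq_mul, mul_one] at h5
    rw [hI.integral_eq]
    linarith
  · obtain ⟨I, hI, -, hIφ⟩ := hint v hv
    rw [hI.integral_eq]
    linarith [hIφ 1 hv1]

/-- The upper envelope of the pricing measures is a cash-additive extension as soon as these
measures charge every strictly positive payoff. -/
theorem isCashAdditiveExtension_iSup (hge : IsCommonOrder ge) (h𝒳 : IsAssetSet ge 𝒳)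
    (h : ∀ f ∈ truncatedAssets 𝒳, StrictOf ge f 0 →
      ∃ m ∈ pricingMeasures ge 𝒳 π, 0 < m.integral (f ⊓ 1)) :
    IsCashAdditiveExtension ge 𝒳 π (truncatedAssets 𝒳)
      fun f => ⨆ m : pricingMeasures ge 𝒳 π, m.1.integral f := by
  -- A pricing measure must exist: a real supremum over an empty index is `0`, which would break
  -- `π₁(1) = 1`.
  obtain ⟨m₀, hm₀, -⟩ := h 1 (Or.inl h𝒳.one_mem) hge.one_gt_zero
  have : Nonempty (pricingMeasures ge 𝒳 π) := ⟨⟨m₀, hm₀⟩⟩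
  have hL : ∀ f ∈ truncatedAssets 𝒳, f ∈ completeAssets ge 𝒳 := fun f hf =>
    h𝒳.truncated_mem_complete hge hf
  have hI : ∀ (m : pricingMeasures ge 𝒳 π), ∀ f ∈ truncatedAssets 𝒳,
      m.1.HasIntegral f (m.1.integral f) := fun m f hf => (m.2.2.1 f (hL f hf)).hasIntegral
  have hbdd : ∀ f ∈ truncatedAssets 𝒳,
      BddAbove (range fun m : pricingMeasures ge 𝒳 π => m.1.integral f) := by
    intro f hf
    obtain ⟨X, hX, hfX⟩ : ∃ X ∈ 𝒳, ∀ ω, f ω ≤ X ω := by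
      rcases hf with hf | ⟨X, hX, k, -, rfl⟩
      · exact ⟨f, hf, fun _ => le_rfl⟩
      · exact ⟨X, hX, fun ω => inf_le_left⟩
    refine ⟨π X, ?_⟩
    rintro _ ⟨m, rfl⟩
    exact (integral_mono_of_mem_pricingMeasures hge m.2 (h𝒳.mem_complete hge hX) (hL f hf)
      (hge.of_le _ _ hfX)).trans (m.2.2.2 X hX)
  have hconst : ∀ (m : FinAddProb Ω) (c : ℝ), m.integral (constFun Ω c) = c := fun m c =>
    (FinAddProb.HasIntegral.const c).integral_eq
  refine ⟨⟨fun f hf c hc hcf => ?_, fun f hf g hg hfg => ?_, ?_, fun f hf g hg hfg => ?_,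
    fun f hf hf0 => ?_⟩, fun f hf a hfa => ?_, fun X hX => ciSup_le fun m => m.2.2.2 X hX⟩
  · rcases hc.eq_or_lt with rfl | hc
    · have : (0 : ℝ) • f = constFun Ω 0 := by ext; simp [constFun]
      simp only [this, hconst, ciSup_const, zero_mul]
    · rw [Real.mul_iSup_of_nonneg hc.le]
      exact iSup_congr fun m => ((hI m f hf).smul hc).integral_eq
  · refine ciSup_le fun m => ?_
    rw [((hI m f hf).add (hI m g hg)).integral_eq]
    exact add_le_add (le_ciSup (hbdd f hf) m) (le_ciSup (hbdd g hg) m)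
  · change ⨆ m : pricingMeasures ge 𝒳 π, m.1.integral (constFun Ω 1) = 1
    simp only [hconst, ciSup_const]
  · exact ciSup_mono (hbdd f hf) fun m =>
      integral_mono_of_mem_pricingMeasures hge m.2 (hL f hf) (hL g hg) hfg
  · obtain ⟨m, hm, hpos⟩ := h f hf hf0
    refine (hpos.trans_le ?_).trans_le (le_ciSup (hbdd f hf) ⟨m, hm⟩)
    exact integral_mono_of_mem_pricingMeasures hge hm (hL f hf)
      (hL _ (inf_one_mem_truncatedAssets hf)) (hge.of_le _ _ fun ω => inf_le_left)
  · refine Eq.trans ?_ (ciSup_add (hbdd f hf) a).symm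
    exact iSup_congr fun m => ((hI m f hf).add (FinAddProb.HasIntegral.const a)).integral_eq

end PricingMeasures

theorem mainTheorem11 {Ω : Type*} (ge : (Ω → ℝ) → (Ω → ℝ) → Prop) (hge : IsCommonOrder ge)
    (𝒳 : Set (Ω → ℝ)) (h𝒳 : IsAssetSet ge 𝒳)
    (π : (Ω → ℝ) → ℝ) (hπ : IsPriceFunction ge 𝒳 π) :
    ((∃ π₁ : (Ω → ℝ) → ℝ, IsCashAdditiveExtension ge 𝒳 π (truncatedAssets 𝒳) π₁) ↔
      uniformClosure (priceCone ge 𝒳 π) ∩ {f | f ∈ truncatedAssets 𝒳 ∧ StrictOf ge f 0} = ∅) ∧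
    (uniformClosure (priceCone ge 𝒳 π) ∩ {f | f ∈ truncatedAssets 𝒳 ∧ StrictOf ge f 0} = ∅ ↔
      ∀ f ∈ truncatedAssets 𝒳, StrictOf ge f 0 →
        0 < ⨆ m ∈ pricingMeasures ge 𝒳 π, ((m.integral (f ⊓ 1) : ℝ) : EReal)) := by
  have h12 : (∃ π₁ : (Ω → ℝ) → ℝ, IsCashAdditiveExtension ge 𝒳 π (truncatedAssets 𝒳) π₁) →
      uniformClosure (priceCone ge 𝒳 π) ∩ {f | f ∈ truncatedAssets 𝒳 ∧ StrictOf ge f 0} = ∅ := by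
    rintro ⟨π₁, h₁⟩
    exact eq_empty_of_forall_notMem fun f ⟨hf, hf₁, hf0⟩ =>
      notMem_uniformClosure_of_extension hge h𝒳 h₁ hf₁ hf0 hf
  have h23 : uniformClosure (priceCone ge 𝒳 π) ∩
      {f | f ∈ truncatedAssets 𝒳 ∧ StrictOf ge f 0} = ∅ → ∀ f ∈ truncatedAssets 𝒳,
      StrictOf ge f 0 → 0 < ⨆ m ∈ pricingMeasures ge 𝒳 π, ((m.integral (f ⊓ 1) : ℝ) : EReal) := by
    intro h f hf hf0
    have hnot : ∀ g ∈ truncatedAssets 𝒳, StrictOf ge g 0 →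
        g ∉ uniformClosure (priceCone ge 𝒳 π) := fun g hg hg0 hgC =>
      (h ▸ ⟨hgC, hg, hg0⟩ : g ∈ (∅ : Set (Ω → ℝ)))
    -- Condition (ii) at `f = 1`; this permits the normalisation `φ(1) = 1`.
    have h1C : (1 : Ω → ℝ) ∉ priceCone ge 𝒳 π := fun h1 =>
      hnot 1 (Or.inl h𝒳.one_mem) hge.one_gt_zero
        (mem_uniformClosure_iff.2 fun ε hε => ⟨1, h1, fun ω => by simpa using hε⟩)
    have hf1 := inf_one_mem_truncatedAssets hf
    obtain ⟨m, hm, hpos⟩ := exists_pricingMeasure_integral_pos hge h𝒳 hπ h1C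
      (h𝒳.truncated_mem_complete hge hf1) (fun ω => inf_le_right)
      (hnot _ hf1 (hge.trunc f hf0))
    -- In `EReal` an empty supremum is `⊥`, so a positive supremum amounts to one measure with
    -- positive integral.
    exact lt_biSup_iff.2 ⟨m, hm, EReal.coe_pos.2 hpos⟩
  have h31 : (∀ f ∈ truncatedAssets 𝒳, StrictOf ge f 0 →
      0 < ⨆ m ∈ pricingMeasures ge 𝒳 π, ((m.integral (f ⊓ 1) : ℝ) : EReal)) →
      ∃ π₁ : (Ω → ℝ) → ℝ, IsCashAdditiveExtension ge 𝒳 π (truncatedAssets 𝒳) π₁ := fun h =>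
    ⟨_, isCashAdditiveExtension_iSup hge h𝒳 fun f hf hf0 => by
      obtain ⟨m, hm, hpos⟩ := lt_biSup_iff.1 (h f hf hf0)
      exact ⟨m, hm, EReal.coe_pos.1 hpos⟩⟩
  exact ⟨⟨h12, h31 ∘ h23⟩, ⟨h23, h12 ∘ h31⟩⟩
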